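/- Let $s,d\in\mathbb N_0$ and let $\Omega\subset\mathbb R^s$ be a convex body (compact, convex, with nonempty interior). Let $\sigma=\{\mathbf x_1,\dots,\mathbf x_m\}\subset\Omega$ be $m=\binom{d+s}{s}$ pairwise distinct points that are unisolvent for Lagrange interpolation by real polynomials in $s$ variables of total degree at most $d$, that is, for all $y_1,\dots,y_m\in\mathbb R$ there is exactly one such polynomial $q$ with $q(\mathbf x_i)=y_i$ for $i=1,\dots,m$. Let $\ell_1,\dots,\ell_m$ be the fundamental Lagrange polynomials (total degree at most $d$, $\ell_i(\mathbf x_j)=\delta_{ij}$) and let $$\Lambda_d(\sigma)=\max_{\mathbf x\in\Omega}\sum_{i=1}^m|\ell_i(\mathbf x)|$$ be the Lebesgue constant. Let $f:\Omega\to\mathbb R$ be of class $C^{d,1}(\Omega)$, that is, $f\in C^d(\Omega)$ and all partial derivatives $D^\alpha f$ with $|\alpha|=d$ are Lipschitz continuous on $\Omega$ (derivatives at boundary points of $\Omega$ being taken relative to $\Omega$). Let $p$ be the polynomial of total degree at most $d$ with $p(\mathbf x_i)=f(\mathbf x_i)$ for $i=1,\dots,m$. Let $\overline{\mathbf x}\in\mathbb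 R^s$, let $h=\max_{i}\|\mathbf x_i-\overline{\mathbf x}\|_2$, and assume that the closed ball $K=B_h(\overline{\mathbf x})$ of radius $h$ centered at $\overline{\mathbf x}$ is contained in $\Omega$. Put $$\|f\|_{d,1}^K=\sup\Big\{\frac{|D^\alpha f(\mathbf u)-D^\alpha f(\mathbf v)|}{\|\mathbf u-\mathbf v\|_2}:\ \mathbf u,\mathbf v\in K,\ \mathbf u\ne\mathbf v,\ |\alpha|=d\Big\}$$ (with $\sup\emptyset=0$), $k_0=1$, $k_j=\dfrac{s^j}{(j-1)!}$ for $j>0$, and, for a multi-index $\nu\in\mathbb N_0^s$, $M_{d,\nu}=\prod_{j=0}^{|\nu|-1}(d-j)^2$. Then for every $\mathbf x\in K$ and every $\nu\in\mathbb N_0^s$ with $|\nu|\le d$, $$\big|D^\nu f(\mathbf x)-D^\nu p(\mathbf x)\big|\le\|f\|_{d,1}^K\,\big(k_{d-|\nu|}+k_d\,M_{d,\nu}\,\Lambda_d(\sigma)\big)\,h^{d-|\nu|+1}.$$ In particular, at $\mathbf x=\overline{\mathbf x}$ the sharper bound $$\big|D^\nu f(\overline{\mathbf x})-D^\nu p(\overline{\mathbf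 x})\big|\le\|f\|_{d,1}^K\,k_d\,M_{d,\nu}\,\Lambda_d(\sigma)\,h^{d-|\nu|+1}$$ holds for every $\nu\in\mathbb N_0^s$ with $|\nu|\le d$. -/

import Mathlib

noncomputable section

namespace PolyInterp

/-- The first-order partial derivative `∂g/∂ξᵢ` relative to the set `Ω`. At points of a convex set
with nonempty interior, and for `g` differentiable relative to `Ω`, this is the usual partial
derivative at interior points and its one-sided (boundary) version at boundary points; for
`Ω = Set.univ` it is the usual partial derivative. -/
def partialWithin {s : ℕ} (Ω : Set (EuclideanSpace ℝ (Fin s))) (i : Fin s)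
    (g : EuclideanSpace ℝ (Fin s) → ℝ) (x : EuclideanSpace ℝ (Fin s)) : ℝ :=
  fderivWithin ℝ g Ω x (EuclideanSpace.single i 1)

/-- The length `|α| = α₁ + ⋯ + α_s` of a multi-index. -/
def multiLength {s : ℕ} (α : Fin s → ℕ) : ℕ := ∑ i, α i

/-- The mixed partial derivative
`D^α f = ∂^{|α|} f / (∂ξ₁^{α₁} ∂ξ₂^{α₂} ⋯ ∂ξ_s^{α_s})` relative to `Ω`, as an iterated
first-order partial derivative. -/
def partialDeriv {s : ℕ} (Ω : Set (EuclideanSpace ℝ (Fin s))) (α : Fin s → ℕ)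
    (f : EuclideanSpace ℝ (Fin s) → ℝ) : EuclideanSpace ℝ (Fin s) → ℝ :=
  (List.finRange s).foldr (fun i g => (partialWithin Ω i)^[α i] g) f

/-- `f` is of class `C^{d,1}(Ω)`: it is `C^d` on `Ω` and all its partial derivatives of order `d`
are Lipschitz continuous on `Ω`. -/
def IsClassCd1 {s : ℕ} (d : ℕ) (Ω : Set (EuclideanSpace ℝ (Fin s)))
    (f : EuclideanSpace ℝ (Fin s) → ℝ) : Prop :=
  ContDiffOn ℝ d f Ω ∧
    ∀ α : Fin s → ℕ, multiLength α = d → ∃ C : NNReal, LipschitzOnWith C (partialDeriv Ω α f) Ω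

/-- The semi-norm `‖f‖_{d,1}^K`, for `K ⊆ Ω` and `f` of class `C^{d,1}(Ω)`: the supremum of
`|D^α f(u) - D^α f(v)| / ‖u - v‖₂` over `u ≠ v` in `K` and `|α| = d`
(it is `0` if there are no such `u`, `v`). -/
def seminorm {s : ℕ} (d : ℕ) (Ω K : Set (EuclideanSpace ℝ (Fin s)))
    (f : EuclideanSpace ℝ (Fin s) → ℝ) : ℝ :=
  sSup {r : ℝ | ∃ α : Fin s → ℕ, multiLength α = d ∧ ∃ u ∈ K, ∃ v ∈ K, u ≠ v ∧
    r = |partialDeriv Ω α f u - partialDeriv Ω α f v| / ‖u - v‖}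

/-- The function on `ℝ^s` given by a polynomial. -/
def polyFun {s : ℕ} (p : MvPolynomial (Fin s) ℝ) (x : EuclideanSpace ℝ (Fin s)) : ℝ :=
  MvPolynomial.eval (fun j => x j) p

/-- The nodes are unisolvent for Lagrange interpolation by polynomials of total degree at most
`d`: for all values there is exactly one interpolating polynomial. -/
def Unisolvent {s m : ℕ} (d : ℕ) (σ : Fin m → EuclideanSpace ℝ (Fin s)) : Prop :=
  ∀ y : Fin m → ℝ, ∃! p : MvPolynomial (Fin s) ℝ,
    p.totalDegree ≤ d ∧ ∀ i, polyFun p (σ i) = y i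

/-- The interpolating polynomial `p[y,σ]` of total degree at most `d`. -/
def interpolant {s m d : ℕ} {σ : Fin m → EuclideanSpace ℝ (Fin s)} (hσ : Unisolvent d σ)
    (y : Fin m → ℝ) : MvPolynomial (Fin s) ℝ :=
  (hσ y).choose

/-- The fundamental Lagrange polynomial `ℓ_i`, with `ℓ_i(x_j) = δ_{ij}`. -/
def lagrange {s m d : ℕ} {σ : Fin m → EuclideanSpace ℝ (Fin s)} (hσ : Unisolvent d σ)
    (i : Fin m) : MvPolynomial (Fin s) ℝ :=
  interpolant hσ (fun j => if i = j then 1 else 0)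

/-- The Lebesgue constant `Λ_d(σ) = max_{x ∈ Ω} ∑ᵢ |ℓ_i(x)|` (a maximum for compact nonempty
`Ω`). -/
def lebesgueConstant {s m d : ℕ} {σ : Fin m → EuclideanSpace ℝ (Fin s)} (hσ : Unisolvent d σ)
    (Ω : Set (EuclideanSpace ℝ (Fin s))) : ℝ :=
  sSup ((fun x => ∑ i, |polyFun (lagrange hσ i) x|) '' Ω)

/-- The radius `h = max_i ‖x_i - x̄‖₂` (the number of nodes is positive in all uses). -/
def nodeRadius {s m : ℕ} (σ : Fin m → EuclideanSpace ℝ (Fin s))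
    (xbar : EuclideanSpace ℝ (Fin s)) : ℝ :=
  ⨆ i, ‖σ i - xbar‖

/-- `k_0 = 1` and `k_j = s^j / (j-1)!` for `j > 0`. -/
def kConst (s : ℕ) : ℕ → ℝ
  | 0 => 1
  | j + 1 => (s : ℝ) ^ (j + 1) / (Nat.factorial j : ℝ)

/-- `M_{d,ν} = ∏_{j=0}^{|ν|-1} (d - j)²`. -/
def MConst {s : ℕ} (d : ℕ) (ν : Fin s → ℕ) : ℝ :=
  ∏ j ∈ Finset.range (multiLength ν), ((d : ℝ) - (j : ℝ)) ^ 2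

end PolyInterp

end

/-! Let `T` be the Taylor polynomial of `f` of degree `d` at the centre of `K`, and split `D^ν f -
D^ν p = D^ν (f - T) - D^ν (p - T)`. The first term is a Taylor remainder, bounded in
`abs_partialDeriv_sub_polyDeriv_le`; it vanishes at the centre, whence the sharper bound there. The
second is a polynomial: at the nodes `p - T` equals `f - T`, so it is at most `‖f‖ k_d h^(d+1)`. The
Lebesgue constant spreads this bound over `Ω`, hence over `K`, and Markov's inequality on the ball,
applied `|ν|` times (`abs_polyDeriv_le`), turns it into a bound for derivatives, each one costing a
factor `degree² / h`.

Markov's inequality comes from trigonometric polynomials. M. Riesz writes the derivative of one of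
degree `n` as a combination of its translates with weights of absolute sum `n`, which is Bernstein's
inequality. Along a chord of the ball this bounds a partial derivative with a weight that vanishes
on the sphere (`sqrt_mul_abs_pderiv_le`); a second use of Bernstein, along a diameter, removes the
weight (`abs_pderiv_le`). -/

noncomputable section

namespace PolyInterp

/-! ### Bernstein and Markov inequalities -/

section Markov
open Real

/-- The trigonometric polynomials of degree at most `n`. -/
def trigPoly (n : ℕ) : Submodule ℝ (ℝ → ℝ) :=
  Submodule.span ℝ {g | ∃ (j : ℤ) (φ : ℝ), j.natAbs ≤ n ∧ g = fun θ => cos (j * θ + φ)}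

lemma trigPoly_mono {m n : ℕ} (h : m ≤ n) : trigPoly m ≤ trigPoly n := by
  apply Submodule.span_mono
  rintro g ⟨j, φ, hj, rfl⟩
  exact ⟨j, φ, hj.trans h, rfl⟩

lemma cos_mem_trigPoly : cos ∈ trigPoly 1 :=
  Submodule.subset_span ⟨1, 0, by simp, by ext; simp⟩

lemma sin_mem_trigPoly : sin ∈ trigPoly 1 :=
  Submodule.subset_span ⟨1, -(π / 2), by simp, by
    ext θ; rw [← sub_eq_add_neg, cos_sub_pi_div_two]; simp⟩

lemma const_mem_trigPoly (c : ℝ) (n : ℕ) : (fun _ => c) ∈ trigPoly n := by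
  have : (fun _ => c : ℝ → ℝ) = c • fun θ => cos (((0 : ℤ) : ℝ) * θ + 0) := by ext; simp
  rw [this]
  exact Submodule.smul_mem _ _ (Submodule.subset_span ⟨0, 0, by simp, rfl⟩)

/-- By bilinearity only products of cosines matter, and product-to-sum gives the frequencies `j + k`
and `j - k`. -/
lemma trigPoly_mul {m n : ℕ} {f g : ℝ → ℝ} (hf : f ∈ trigPoly m) (hg : g ∈ trigPoly n) :
    f * g ∈ trigPoly (m + n) := by
  refine Submodule.span_induction₂ (p := fun f g _ _ => f * g ∈ trigPoly (m + n))
    ?_ ?_ ?_ ?_ ?_ ?_ ?_ hf hg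
  · rintro _ _ ⟨j, φ, hj, rfl⟩ ⟨k, ψ, hk, rfl⟩
    have : (fun θ => cos (j * θ + φ)) * (fun θ => cos (k * θ + ψ)) =
        (1 / 2 : ℝ) • ((fun θ => cos (((j + k : ℤ) : ℝ) * θ + (φ + ψ))) +
          fun θ => cos (((j - k : ℤ) : ℝ) * θ + (φ - ψ))) := by
      ext θ
      simp only [Pi.mul_apply, Pi.smul_apply, Pi.add_apply, smul_eq_mul, Int.cast_add,
        Int.cast_sub]
      rw [show ((j : ℝ) + k) * θ + (φ + ψ) = (j * θ + φ) + (k * θ + ψ) by ring,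
        show ((j : ℝ) - k) * θ + (φ - ψ) = (j * θ + φ) - (k * θ + ψ) by ring,
        cos_add (j * θ + φ), cos_sub (j * θ + φ)]
      ring
    rw [this]
    refine Submodule.smul_mem _ _ (Submodule.add_mem _ ?_ ?_)
    · exact Submodule.subset_span ⟨_, _, by omega, rfl⟩
    · exact Submodule.subset_span ⟨_, _, by omega, rfl⟩
  · intro y _; simp
  · intro x _; simp
  · intro x y z _ _ _ h1 h2; rw [add_mul]; exact Submodule.add_mem _ h1 h2
  · intro x y z _ _ _ h1 h2; rw [mul_add]; exact Submodule.add_mem _ h1 h2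
  · intro r x y _ _ h; rw [smul_mul_assoc]; exact Submodule.smul_mem _ _ h
  · intro r x y _ _ h; rw [mul_smul_comm]; exact Submodule.smul_mem _ _ h

/-- The nodes of the interpolation formula of M. Riesz. -/
def rieszNode (n k : ℕ) : ℝ := (2 * k + 1) * π / (2 * n)

/-- The weights of the interpolation formula of M. Riesz. -/
def rieszWeight (n k : ℕ) : ℝ :=
  sin (n * rieszNode n k) / (4 * n * sin (rieszNode n k / 2) ^ 2)

/-! ### Riesz's interpolation formula -/

section Riesz
variable {n : ℕ}

lemma mul_rieszNode (hn : 0 < n) (k : ℕ) : n * rieszNode n k = k * π + π / 2 := by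
  unfold rieszNode; field_simp

lemma cos_mul_rieszNode (hn : 0 < n) (k : ℕ) : cos (n * rieszNode n k) = 0 := by
  rw [mul_rieszNode hn, cos_add_pi_div_two, sin_nat_mul_pi, neg_zero]

lemma sin_sq_mul_rieszNode (hn : 0 < n) (k : ℕ) : sin (n * rieszNode n k) ^ 2 = 1 := by
  have := sin_sq_add_cos_sq (n * rieszNode n k)
  rwa [cos_mul_rieszNode hn, zero_pow two_ne_zero, add_zero] at this

lemma sin_half_rieszNode_pos (hn : 0 < n) {k : ℕ} (hk : k < 2 * n) :
    0 < sin (rieszNode n k / 2) := by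
  have hn' : (0 : ℝ) < n := by exact_mod_cast hn
  have hk' : (k : ℝ) + 1 ≤ 2 * n := by exact_mod_cast hk
  apply sin_pos_of_pos_of_lt_pi
  · unfold rieszNode; positivity
  · unfold rieszNode
    rw [div_div, div_lt_iff₀ (by positivity)]
    nlinarith [pi_pos]

/-- Multiplication by `2 sin (mπ / 2n)`, nonzero in this range of `m`, makes the sum telescope over
a multiple of the period. -/
lemma sum_cos_rieszNode (hn : 0 < n) {m : ℕ} (hm : 0 < m) (hmn : m < 2 * n) :
    ∑ k ∈ Finset.range (2 * n), cos (m * rieszNode n k) = 0 := by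
  have hn' : (0 : ℝ) < n := by exact_mod_cast hn
  have hm' : (0 : ℝ) < m := by exact_mod_cast hm
  have hmn' : (m : ℝ) < 2 * n := by exact_mod_cast hmn
  have hs : 0 < sin (m * π / (2 * n)) := by
    apply sin_pos_of_pos_of_lt_pi
    · positivity
    · rw [div_lt_iff₀ (by positivity)]; nlinarith [pi_pos]
  have key : ∀ k : ℕ, 2 * sin (m * π / (2 * n)) * cos (m * rieszNode n k) =
      sin (m * (k + 1 : ℕ) * π / n) - sin (m * k * π / n) := by
    intro k
    rw [sin_sub_sin]
    congr 1
    · congr 2; push_cast; field_simp; ring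
    · congr 1; unfold rieszNode; push_cast; field_simp; ring
  have : 2 * sin (m * π / (2 * n)) *
      ∑ k ∈ Finset.range (2 * n), cos (m * rieszNode n k) = 0 := by
    rw [Finset.mul_sum, Finset.sum_congr rfl fun k _ => key k,
      Finset.sum_range_sub (fun k : ℕ => sin (m * k * π / n))]
    have h2 : (m : ℝ) * (2 * n : ℕ) * π / n = m * (2 * π) := by
      push_cast; field_simp
    have h3 := sin_nat_mul_pi (m * 2)
    rw [h2, show (m : ℝ) * (2 * π) = ((m * 2 : ℕ) : ℝ) * π by push_cast; ring, h3]
    simp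
  rcases mul_eq_zero.1 this with h | h
  · linarith
  · exact h

lemma sum_sin_mul_sin_rieszNode {j : ℕ} (hj : j < n) :
    ∑ k ∈ Finset.range (2 * n), sin (n * rieszNode n k) * sin (j * rieszNode n k) = 0 := by
  have key : ∀ k : ℕ, sin (n * rieszNode n k) * sin (j * rieszNode n k) =
      (cos ((n - j : ℕ) * rieszNode n k) - cos ((n + j : ℕ) * rieszNode n k)) / 2 := by
    intro k
    rw [Nat.cast_sub hj.le, Nat.cast_add, sub_mul, add_mul, cos_sub, cos_add]
    ring
  rw [Finset.sum_congr rfl fun k _ => key k, ← Finset.sum_div, Finset.sum_sub_distrib,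
    sum_cos_rieszNode (by omega) (by omega) (by omega),
    sum_cos_rieszNode (by omega) (by omega) (by omega)]
  simp

lemma rieszWeight_mul (hn : 0 < n) {k : ℕ} (hk : k < 2 * n) :
    rieszWeight n k * (4 * sin (rieszNode n k / 2) ^ 2) = sin (n * rieszNode n k) / n := by
  have := (sin_half_rieszNode_pos hn hk).ne'
  have hn' : (n : ℝ) ≠ 0 := by positivity
  unfold rieszWeight
  field_simp

lemma sin_second_difference (a θ : ℝ) :
    sin ((a + 2) * θ) - 2 * sin ((a + 1) * θ) + sin (a * θ) =
      -(4 * sin (θ / 2) ^ 2) * sin ((a + 1) * θ) := by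
  have h1 : cos θ = 1 - 2 * sin (θ / 2) ^ 2 := by
    have := cos_two_mul (θ / 2)
    rw [mul_div_cancel₀ _ two_ne_zero] at this
    rw [this, cos_sq']; ring
  rw [show (a + 2) * θ = (a + 1) * θ + θ by ring,
    show a * θ = (a + 1) * θ - θ by ring, sin_add, sin_sub, h1]
  ring

/-- A second difference in the frequency produces the factor `-4 sin² (θ / 2)`, which cancels the
denominator of the weight. -/
lemma rieszSum_second_difference (hn : 0 < n) (j : ℕ) :
    (∑ k ∈ Finset.range (2 * n), rieszWeight n k * sin ((j + 2 : ℕ) * rieszNode n k))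
      - 2 * (∑ k ∈ Finset.range (2 * n), rieszWeight n k * sin ((j + 1 : ℕ) * rieszNode n k))
      + (∑ k ∈ Finset.range (2 * n), rieszWeight n k * sin (j * rieszNode n k)) =
    -(∑ k ∈ Finset.range (2 * n), sin (n * rieszNode n k) * sin ((j + 1 : ℕ) * rieszNode n k))
      / n := by
  rw [Finset.mul_sum, ← Finset.sum_sub_distrib, ← Finset.sum_add_distrib, neg_div,
    Finset.sum_div, ← Finset.sum_neg_distrib]
  refine Finset.sum_congr rfl fun k hk => ?_
  have h1 := rieszWeight_mul hn (Finset.mem_range.1 hk)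
  have h2 := sin_second_difference j (rieszNode n k)
  push_cast
  linear_combination rieszWeight n k * h2 - sin ((j + 1) * rieszNode n k) * h1

/-- By orthogonality the second differences centred below `n` vanish, so the sum is linear in `j` up
to `n`. The one centred at `n` fixes the slope. -/
lemma sum_rieszWeight_mul_sin (hn : 0 < n) {j : ℕ} (hj : j ≤ n) :
    ∑ k ∈ Finset.range (2 * n), rieszWeight n k * sin (j * rieszNode n k) = j := by
  have hn' : (n : ℝ) ≠ 0 := by positivity
  set S : ℕ → ℝ := fun j =>
    ∑ k ∈ Finset.range (2 * n), rieszWeight n k * sin (j * rieszNode n k) with hS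
  have h0 : S 0 = 0 := by simp [hS]
  have hdiff : ∀ j, j + 1 ≤ n → S (j + 1) - S j = S 1 := by
    intro j hj
    induction j with
    | zero => simp [h0]
    | succ j ih =>
      have h := rieszSum_second_difference hn j
      rw [sum_sin_mul_sin_rieszNode (by omega), neg_zero, zero_div] at h
      have := ih (by omega)
      change S (j + 2) - 2 * S (j + 1) + S j = 0 at h
      change S (j + 2) - S (j + 1) = S 1
      linarith
  have hS1 : S 1 = 1 := by
    -- At centre `n = m + 1` the second difference is `-2n / n = -2`. Since `cos (nθ) = 0` at the
    -- nodes, `S (n + 1) = S (n - 1)`, so the last increment is `1`.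
    obtain ⟨m, rfl⟩ : ∃ m, n = m + 1 := ⟨n - 1, by omega⟩
    have h := rieszSum_second_difference hn m
    rw [Finset.sum_congr rfl fun k _ => (pow_two (sin (((m + 1 : ℕ) : ℝ) *
      rieszNode (m + 1) k))).symm, Finset.sum_congr rfl fun k _ => sin_sq_mul_rieszNode hn k] at h
    change S (m + 2) - 2 * S (m + 1) + S m = _ at h
    have hsym : S (m + 2) = S m := by
      refine Finset.sum_congr rfl fun k _ => ?_
      have hc := cos_mul_rieszNode hn k
      rw [show ((m + 2 : ℕ) : ℝ) * rieszNode (m + 1) k =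
          (m + 1 : ℕ) * rieszNode (m + 1) k + rieszNode (m + 1) k by push_cast; ring,
        show (m : ℝ) * rieszNode (m + 1) k =
          (m + 1 : ℕ) * rieszNode (m + 1) k - rieszNode (m + 1) k by push_cast; ring,
        sin_add, sin_sub, hc]
      ring
    have := hdiff m le_rfl
    have hval : -(∑ _k ∈ Finset.range (2 * (m + 1)), (1 : ℝ)) / (m + 1 : ℕ) = -2 := by
      rw [Finset.sum_const, Finset.card_range]
      push_cast at hn' ⊢
      simp only [nsmul_eq_mul]
      push_cast
      field_simp
    rw [hval] at h
    linarith
  change S j = j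
  induction j with
  | zero => simp [h0]
  | succ j ih =>
    have := hdiff j hj
    have := ih (by omega)
    push_cast
    linarith

/-- The reflection `θ ↦ 2π - θ` permutes the nodes; it changes the sign of the weight and preserves
the cosine. -/
lemma sum_rieszWeight_mul_cos (hn : 0 < n) (j : ℕ) :
    ∑ k ∈ Finset.range (2 * n), rieszWeight n k * cos (j * rieszNode n k) = 0 := by
  have h := Finset.sum_range_reflect
    (fun k => rieszWeight n k * cos (j * rieszNode n k)) (2 * n)
  have hn' : (n : ℝ) ≠ 0 := by positivity
  have key : ∀ k ∈ Finset.range (2 * n),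
      rieszWeight n (2 * n - 1 - k) * cos (j * rieszNode n (2 * n - 1 - k)) =
        -(rieszWeight n k * cos (j * rieszNode n k)) := by
    intro k hk
    have hk' := Finset.mem_range.1 hk
    have hnode : rieszNode n (2 * n - 1 - k) = 2 * π - rieszNode n k := by
      unfold rieszNode
      rw [Nat.cast_sub (by omega), Nat.cast_sub (by omega)]
      push_cast
      field_simp
      ring
    have hcos : cos (j * (2 * π - rieszNode n k)) = cos (j * rieszNode n k) := by
      rw [mul_sub, cos_nat_mul_two_pi_sub]
    have hsin : sin (n * (2 * π - rieszNode n k)) = -sin (n * rieszNode n k) := by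
      rw [mul_sub, sin_nat_mul_two_pi_sub]
    have hhalf : sin ((2 * π - rieszNode n k) / 2) = sin (rieszNode n k / 2) := by
      rw [show (2 * π - rieszNode n k) / 2 = π - rieszNode n k / 2 by ring, sin_pi_sub]
    unfold rieszWeight
    rw [hnode, hcos, hsin, hhalf]
    ring
  rw [Finset.sum_congr rfl key, Finset.sum_neg_distrib] at h
  linarith

/-- The weight has the sign of `sin (nθ) = ±1`, so this is the sine sum at frequency `n`. -/
lemma sum_abs_rieszWeight (hn : 0 < n) :
    ∑ k ∈ Finset.range (2 * n), |rieszWeight n k| = n := by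
  rw [← sum_rieszWeight_mul_sin hn le_rfl]
  refine Finset.sum_congr rfl fun k _ => ?_
  have h1 := sin_sq_mul_rieszNode hn k
  have h2 : rieszWeight n k * sin (n * rieszNode n k) =
      1 / (4 * n * sin (rieszNode n k / 2) ^ 2) := by
    unfold rieszWeight; rw [div_mul_eq_mul_div, ← pow_two, h1]
  have h3 : |sin (n * rieszNode n k)| = 1 := by
    rcases mul_self_eq_one_iff.1 ((pow_two _).symm.trans h1) with h | h <;> simp [h]
  have : 0 ≤ rieszWeight n k * sin (n * rieszNode n k) := by rw [h2]; positivity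
  rw [← abs_of_nonneg this, abs_mul, h3, mul_one]

/-- The interpolation formula of M. Riesz for the derivative of a trigonometric polynomial. -/
lemma hasDerivAt_trigPoly (hn : 0 < n) {g : ℝ → ℝ} (hg : g ∈ trigPoly n) (θ : ℝ) :
    HasDerivAt g (∑ k ∈ Finset.range (2 * n), rieszWeight n k * g (θ + rieszNode n k)) θ := by
  induction hg using Submodule.span_induction with
  | mem g hg =>
    obtain ⟨j, φ, hj, rfl⟩ := hg
    have hS : ∑ k ∈ Finset.range (2 * n), rieszWeight n k * sin (j * rieszNode n k) = j := by
      obtain ⟨m, rfl | rfl⟩ := j.eq_nat_or_neg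
      · exact_mod_cast sum_rieszWeight_mul_sin hn (j := m) (by omega)
      · simpa using sum_rieszWeight_mul_sin hn (j := m) (by omega)
    have hC : ∑ k ∈ Finset.range (2 * n), rieszWeight n k * cos (j * rieszNode n k) = 0 := by
      obtain ⟨m, rfl | rfl⟩ := j.eq_nat_or_neg
      · exact_mod_cast sum_rieszWeight_mul_cos hn m
      · simpa using sum_rieszWeight_mul_cos hn m
    have hd : HasDerivAt (fun θ => cos (j * θ + φ)) (-sin (j * θ + φ) * (j * 1)) θ :=
      (((hasDerivAt_id θ).const_mul (j : ℝ)).add_const φ).cos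
    convert hd using 1
    have : ∀ k, rieszWeight n k * cos (j * (θ + rieszNode n k) + φ) =
        cos (j * θ + φ) * (rieszWeight n k * cos (j * rieszNode n k)) -
          sin (j * θ + φ) * (rieszWeight n k * sin (j * rieszNode n k)) := by
      intro k
      rw [show j * (θ + rieszNode n k) + φ = (j * θ + φ) + j * rieszNode n k by ring, cos_add]
      ring
    simp only [this, Finset.sum_sub_distrib, ← Finset.mul_sum, hS, hC]
    ring
  | zero => simp [Pi.zero_def, hasDerivAt_const]
  | add f g _ _ h1 h2 =>
    simp only [Pi.add_apply, mul_add, Finset.sum_add_distrib]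
    exact h1.add h2
  | smul a g _ h =>
    simp only [Pi.smul_apply, smul_eq_mul, mul_left_comm _ a, ← Finset.mul_sum]
    exact h.const_smul a

/-- Bernstein's inequality for trigonometric polynomials. -/
lemma abs_deriv_le_of_mem_trigPoly (hn : 0 < n) {g : ℝ → ℝ} (hg : g ∈ trigPoly n) {A : ℝ}
    (hA : ∀ θ, |g θ| ≤ A) {θ g' : ℝ} (hg' : HasDerivAt g g' θ) : |g'| ≤ n * A := by
  rw [hg'.unique (hasDerivAt_trigPoly hn hg θ)]
  calc _ ≤ ∑ k ∈ Finset.range (2 * n), |rieszWeight n k * g (θ + rieszNode n k)| :=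
        Finset.abs_sum_le_sum_abs _ _
    _ ≤ ∑ k ∈ Finset.range (2 * n), |rieszWeight n k| * A := by
        refine Finset.sum_le_sum fun k _ => ?_
        rw [abs_mul]
        exact mul_le_mul_of_nonneg_left (hA _) (abs_nonneg _)
    _ = n * A := by rw [← Finset.sum_mul, sum_abs_rieszWeight hn]

end Riesz

/-! ### Polynomials on a ball -/

variable {s : ℕ}

lemma polyFun_C (a : ℝ) : polyFun (s := s) (MvPolynomial.C a) = fun _ => a := by
  ext; simp [polyFun]

lemma polyFun_add (p q : MvPolynomial (Fin s) ℝ) : polyFun (p + q) = polyFun p + polyFun q := by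
  ext; simp [polyFun]

lemma polyFun_mul_X (p : MvPolynomial (Fin s) ℝ) (j : Fin s) :
    polyFun (p * MvPolynomial.X j) = polyFun p * fun x => x j := by
  ext; simp [polyFun]

lemma hasFDerivAt_polyFun (q : MvPolynomial (Fin s) ℝ) (x : EuclideanSpace ℝ (Fin s)) :
    HasFDerivAt (polyFun q)
      (∑ i, polyFun (MvPolynomial.pderiv i q) x •
        (EuclideanSpace.proj i : EuclideanSpace ℝ (Fin s) →L[ℝ] ℝ)) x := by
  induction q using MvPolynomial.induction_on with
  | C a =>
    rw [polyFun_C]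
    refine (hasFDerivAt_const a x).congr_fderiv ?_
    simp [polyFun]
  | add p q hp hq =>
    rw [polyFun_add]
    refine (hp.add hq).congr_fderiv ?_
    simp [polyFun, add_smul, Finset.sum_add_distrib]
  | mul_X p j hp =>
    have h2 : HasFDerivAt (fun x : EuclideanSpace ℝ (Fin s) => x j)
      (EuclideanSpace.proj (𝕜 := ℝ) j) x := (EuclideanSpace.proj (𝕜 := ℝ) j).hasFDerivAt
    rw [polyFun_mul_X]
    refine (hp.mul h2).congr_fderiv ?_
    ext v
    simp [polyFun, Derivation.leibniz, MvPolynomial.pderiv_X, add_mul, Finset.sum_add_distrib,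
      Pi.single_apply, Finset.mul_sum, mul_assoc, apply_ite]

lemma contDiff_polyFun (q : MvPolynomial (Fin s) ℝ) (n : WithTop ℕ∞) :
    ContDiff ℝ n (polyFun q) := by
  induction q using MvPolynomial.induction_on with
  | C a => rw [polyFun_C]; exact contDiff_const
  | add p q hp hq => rw [polyFun_add]; exact hp.add hq
  | mul_X p j hp =>
    rw [polyFun_mul_X]
    exact hp.mul (EuclideanSpace.proj j : EuclideanSpace ℝ (Fin s) →L[ℝ] ℝ).contDiff

lemma totalDegree_pderiv_le (i : Fin s) {q : MvPolynomial (Fin s) ℝ} {n : ℕ}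
    (hq : q.totalDegree ≤ n) : (MvPolynomial.pderiv i q).totalDegree ≤ n - 1 := by
  rw [MvPolynomial.totalDegree, Finset.sup_le_iff]
  intro m hm
  rw [MvPolynomial.mem_support_iff, MvPolynomial.coeff_pderiv] at hm
  have h1 := MvPolynomial.le_totalDegree
    (MvPolynomial.mem_support_iff.2 (left_ne_zero_of_mul hm))
  rw [Finsupp.sum_add_index' (by simp) (by simp), Finsupp.sum_single_index rfl] at h1
  omega

lemma polyFun_comp_mem_trigPoly {n : ℕ} {q : MvPolynomial (Fin s) ℝ} (hq : q.totalDegree ≤ n)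
    (a b : EuclideanSpace ℝ (Fin s)) :
    (fun θ => polyFun q (a + cos θ • b)) ∈ trigPoly n := by
  have hlin : ∀ j, (fun θ => (a + cos θ • b) j) ∈ trigPoly 1 := by
    intro j
    have : (fun θ => (a + cos θ • b) j) = (fun _ => a j) + b j • cos := by
      ext θ; simp [mul_comm]
    rw [this]
    exact Submodule.add_mem _ (const_mem_trigPoly _ _)
      (Submodule.smul_mem _ _ cos_mem_trigPoly)
  have hpow : ∀ j k, (fun θ => (a + cos θ • b) j) ^ k ∈ trigPoly k := by
    intro j k
    induction k with
    | zero => simpa [Pi.one_def] using const_mem_trigPoly 1 0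
    | succ k ih => rw [pow_succ]; exact trigPoly_mul ih (hlin j)
  have hprod : ∀ (m : Fin s →₀ ℕ) (t : Finset (Fin s)),
      ∏ j ∈ t, (fun θ => (a + cos θ • b) j) ^ m j ∈ trigPoly (∑ j ∈ t, m j) := by
    intro m t
    induction t using Finset.induction_on with
    | empty => simpa [Pi.one_def] using const_mem_trigPoly 1 0
    | insert j t hj ih =>
      rw [Finset.prod_insert hj, Finset.sum_insert hj]
      exact trigPoly_mul (hpow j _) ih
  have : (fun θ => polyFun q (a + cos θ • b)) =
      ∑ m ∈ q.support, q.coeff m • ∏ j ∈ m.support, (fun θ => (a + cos θ • b) j) ^ m j := by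
    ext θ
    simp [polyFun, MvPolynomial.eval_eq, Finset.sum_apply, Finset.prod_apply]
  rw [this]
  refine Submodule.sum_mem _ fun m hm => Submodule.smul_mem _ _ ?_
  exact trigPoly_mono ((MvPolynomial.le_totalDegree hm).trans hq) (hprod m m.support)

/-- The Bernstein inequality on a ball. -/
lemma sqrt_mul_abs_pderiv_le {n : ℕ} (hn : 0 < n) {q : MvPolynomial (Fin s) ℝ}
    (hq : q.totalDegree ≤ n) {c : EuclideanSpace ℝ (Fin s)} {h A : ℝ} (hA : 0 ≤ A)
    (hqA : ∀ x ∈ Metric.closedBall c h, |polyFun q x| ≤ A) (i : Fin s)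
    {y : EuclideanSpace ℝ (Fin s)} (hy : ‖y‖ ≤ h) :
    √(h ^ 2 - ‖y‖ ^ 2) * |polyFun (MvPolynomial.pderiv i q) (c + y)| ≤ n * A := by
  have hh : 0 ≤ h := (norm_nonneg y).trans hy
  have hyi : y i ^ 2 ≤ ‖y‖ ^ 2 := by
    rw [EuclideanSpace.real_norm_sq_eq]
    exact Finset.single_le_sum (f := fun j => y j ^ 2) (fun j _ => sq_nonneg _) (Finset.mem_univ i)
  have hyh : ‖y‖ ^ 2 ≤ h ^ 2 := pow_le_pow_left₀ (norm_nonneg _) hy 2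
  rcases eq_or_lt_of_le hyh with heq | hlt
  · rw [heq]; simp; positivity
  -- `R` is the half-length of the chord through `c + y` in the `i`-th direction; its midpoint is `c
  -- + y - y i • e`. The map `θ ↦ midpoint + cos θ • (R • e)` sweeps this chord.
  set R := √(h ^ 2 - ‖y‖ ^ 2 + y i ^ 2) with hR
  have hR2 : R ^ 2 = h ^ 2 - ‖y‖ ^ 2 + y i ^ 2 := sq_sqrt (by nlinarith [sq_nonneg (y i)])
  have hRpos : 0 < R := sqrt_pos.2 (by nlinarith [sq_nonneg (y i)])
  set e : EuclideanSpace ℝ (Fin s) := EuclideanSpace.single i 1 with he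
  set g : ℝ → ℝ := fun θ => polyFun q ((c + y - y i • e) + cos θ • (R • e)) with hg
  have hgmem : g ∈ trigPoly n := polyFun_comp_mem_trigPoly hq _ _
  have hball : ∀ θ, |g θ| ≤ A := by
    intro θ
    apply hqA
    rw [mem_closedBall_iff_norm]
    have : c + y - y i • e + cos θ • R • e - c = y + (R * cos θ - y i) • e := by module
    rw [this]
    refine (sq_le_sq₀ (norm_nonneg _) hh).1 ?_
    rw [norm_add_sq_real, inner_smul_right, norm_smul, he, EuclideanSpace.inner_single_right,
      PiLp.norm_single]
    simp
    nlinarith [sin_sq_add_cos_sq θ, sq_nonneg (R * sin θ)]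
  have hz : |y i| ≤ R := abs_le.2 (abs_le_of_sq_le_sq' (by nlinarith) hRpos.le)
  have hz' := abs_le.1 hz
  set θ₀ := arccos (y i / R) with hθ
  have hcos : cos θ₀ = y i / R :=
    cos_arccos (by rw [le_div_iff₀ hRpos]; linarith) (by rw [div_le_iff₀ hRpos]; linarith)
  have hsin : R * sin θ₀ = √(h ^ 2 - ‖y‖ ^ 2) := by
    rw [hθ, sin_arccos]
    nth_rewrite 1 [← sqrt_sq hRpos.le]
    rw [← sqrt_mul (sq_nonneg R)]
    congr 1
    field_simp
    linarith
  have hpt : (c + y - y i • e) + cos θ₀ • (R • e) = c + y := by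
    rw [hcos, smul_smul, div_mul_cancel₀ _ hRpos.ne']; module
  have hder : HasDerivAt g (-(R * sin θ₀) * polyFun (MvPolynomial.pderiv i q) (c + y)) θ₀ := by
    have h1 : HasDerivAt (fun θ => (c + y - y i • e) + cos θ • (R • e)) (-sin θ₀ • (R • e)) θ₀ :=
      ((hasDerivAt_cos θ₀).smul_const _).const_add _
    have h2 := (hasFDerivAt_polyFun q ((c + y - y i • e) + cos θ₀ • (R • e))).comp_hasDerivAt θ₀ h1
    refine h2.congr_deriv ?_
    rw [hpt]
    simp [he]
    ring
  have := abs_deriv_le_of_mem_trigPoly hn hgmem hball hder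
  rwa [hsin, abs_mul, abs_neg, abs_of_nonneg (sqrt_nonneg _)] at this

/-- The Markov inequality on a ball. -/
lemma abs_pderiv_le {n : ℕ} {q : MvPolynomial (Fin s) ℝ}
    (hq : q.totalDegree ≤ n) {c : EuclideanSpace ℝ (Fin s)} {h A : ℝ} (hh : 0 < h)
    (hqA : ∀ x ∈ Metric.closedBall c h, |polyFun q x| ≤ A) (i : Fin s)
    {x : EuclideanSpace ℝ (Fin s)} (hx : x ∈ Metric.closedBall c h) :
    |polyFun (MvPolynomial.pderiv i q) x| ≤ (n : ℝ) ^ 2 * A / h := by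
  have hA : 0 ≤ A := (abs_nonneg _).trans (hqA x hx)
  rcases Nat.eq_zero_or_pos n with rfl | hn
  · rw [MvPolynomial.totalDegree_eq_zero_iff_eq_C.1 (Nat.le_zero.1 hq)]
    simp [polyFun]
  set y := x - c with hy
  have hyh : ‖y‖ ≤ h := mem_closedBall_iff_norm.1 hx
  set r := MvPolynomial.pderiv i q with hr
  set g : ℝ → ℝ := fun θ => polyFun r (c + cos θ • y) with hg
  -- The factor `sin` restores the degree lost by differentiating. Since `h |sin θ| ≤ √(h² - ‖cos θ
  -- • y‖²)`, the weighted bound gives `|g sin| ≤ n A / h`. The derivative of `g sin` at `0` is `g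
  -- 0`, the value sought, and Bernstein supplies the second factor `n`.
  have hmem : g * sin ∈ trigPoly n := by
    have := trigPoly_mul (polyFun_comp_mem_trigPoly (totalDegree_pderiv_le i hq) c y)
      sin_mem_trigPoly
    rwa [Nat.sub_add_cancel hn] at this
  have hbound : ∀ θ, |(g * sin) θ| ≤ n * A / h := by
    intro θ
    have hcy : ‖cos θ • y‖ ≤ h := by
      rw [norm_smul, norm_eq_abs]
      exact (mul_le_of_le_one_left (norm_nonneg _) (abs_cos_le_one θ)).trans hyh
    have h1 := sqrt_mul_abs_pderiv_le hn hq hA hqA i hcy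
    rw [le_div_iff₀ hh, Pi.mul_apply, abs_mul]
    refine le_trans ?_ h1
    rw [mul_assoc, mul_comm]
    refine mul_le_mul_of_nonneg_right ?_ (abs_nonneg _)
    apply le_sqrt_of_sq_le
    rw [mul_pow, sq_abs, norm_smul, mul_pow, norm_eq_abs, sq_abs]
    have : ‖y‖ ^ 2 ≤ h ^ 2 := pow_le_pow_left₀ (norm_nonneg _) hyh 2
    nlinarith [sin_sq_add_cos_sq θ, mul_le_mul_of_nonneg_left this (sq_nonneg (cos θ))]
  have hder : HasDerivAt (g * sin) (polyFun r x) 0 := by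
    have hgd := hasDerivAt_trigPoly hn
      (trigPoly_mono (n.sub_le 1) (polyFun_comp_mem_trigPoly (totalDegree_pderiv_le i hq) c y)) 0
    refine (hgd.mul (hasDerivAt_sin 0)).congr_deriv ?_
    simp [hy, hr]
  refine (abs_deriv_le_of_mem_trigPoly hn hmem hbound hder).trans_eq ?_
  ring

end Markov

/-! ### Partial derivatives relative to a convex body -/

section Partial
variable {s : ℕ} {Ω : Set (EuclideanSpace ℝ (Fin s))}

lemma contDiffOn_partialWithin (hu : UniqueDiffOn ℝ Ω) {n : ℕ} {g : EuclideanSpace ℝ (Fin s) → ℝ}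
    (hg : ContDiffOn ℝ (n + 1 : ℕ) g Ω) (i : Fin s) :
    ContDiffOn ℝ n (partialWithin Ω i g) Ω :=
  (hg.fderivWithin hu (by norm_cast)).clm_apply contDiffOn_const

lemma contDiffOn_iterate_partialWithin (hu : UniqueDiffOn ℝ Ω) {n k : ℕ}
    {g : EuclideanSpace ℝ (Fin s) → ℝ} (hg : ContDiffOn ℝ (n + k : ℕ) g Ω) (i : Fin s) :
    ContDiffOn ℝ n ((partialWithin Ω i)^[k] g) Ω := by
  induction k generalizing g with
  | zero => exact hg
  | succ k ih =>
    rw [Function.iterate_succ_apply]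
    exact ih (contDiffOn_partialWithin hu hg i)

lemma eqOn_partialWithin {g g' : EuclideanSpace ℝ (Fin s) → ℝ} (h : Set.EqOn g g' Ω) (i : Fin s) :
    Set.EqOn (partialWithin Ω i g) (partialWithin Ω i g') Ω := by
  intro x hx
  unfold partialWithin
  rw [fderivWithin_congr h (h hx)]

lemma eqOn_iterate_partialWithin {g g' : EuclideanSpace ℝ (Fin s) → ℝ} (h : Set.EqOn g g' Ω)
    (i : Fin s) (k : ℕ) :
    Set.EqOn ((partialWithin Ω i)^[k] g) ((partialWithin Ω i)^[k] g') Ω := by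
  induction k generalizing g g' with
  | zero => exact h
  | succ k ih => exact ih (eqOn_partialWithin h i)

/-- Symmetry of the second derivative holds at boundary points too, because a convex set with
nonempty interior lies in the closure of its interior. -/
lemma eqOn_partialWithin_comm (hconv : Convex ℝ Ω) (hint : (interior Ω).Nonempty)
    {g : EuclideanSpace ℝ (Fin s) → ℝ} (hg : ContDiffOn ℝ 2 g Ω) (i j : Fin s) :
    Set.EqOn (partialWithin Ω i (partialWithin Ω j g)) (partialWithin Ω j (partialWithin Ω i g))
      Ω := by
  have hu := uniqueDiffOn_convex hconv hint
  intro x hx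
  have hd : DifferentiableWithinAt ℝ (fderivWithin ℝ g Ω) Ω x :=
    ((hg.fderivWithin (m := 1) hu (by norm_num)).differentiableOn one_ne_zero) x hx
  have key : ∀ i j : Fin s, partialWithin Ω i (partialWithin Ω j g) x =
      fderivWithin ℝ (fderivWithin ℝ g Ω) Ω x (EuclideanSpace.single i 1)
        (EuclideanSpace.single j 1) := by
    intro i j
    change fderivWithin ℝ (fun y => fderivWithin ℝ g Ω y (EuclideanSpace.single j 1)) Ω x
      (EuclideanSpace.single i 1) = _
    rw [fderivWithin_clm_apply (hu x hx) hd (differentiableWithinAt_const _)]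
    simp
  rw [key, key]
  refine (hg x hx).isSymmSndFDerivWithinAt (by simp) hu ?_ hx _ _
  rw [hconv.closure_interior_eq_closure_of_nonempty_interior hint]
  exact subset_closure hx

lemma eqOn_partialWithin_iterate_comm (hconv : Convex ℝ Ω) (hint : (interior Ω).Nonempty) {k : ℕ}
    {g : EuclideanSpace ℝ (Fin s) → ℝ} (hg : ContDiffOn ℝ (k + 1 : ℕ) g Ω) (i j : Fin s) :
    Set.EqOn (partialWithin Ω i ((partialWithin Ω j)^[k] g))
      ((partialWithin Ω j)^[k] (partialWithin Ω i g)) Ω := by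
  have hu := uniqueDiffOn_convex hconv hint
  induction k generalizing g with
  | zero => exact Set.eqOn_refl _ _
  | succ k ih =>
    simp only [Function.iterate_succ_apply]
    refine (ih (contDiffOn_partialWithin hu hg j)).trans ?_
    apply eqOn_iterate_partialWithin
    refine eqOn_partialWithin_comm hconv hint (hg.of_le ?_) i j
    norm_cast
    omega

lemma contDiffOn_foldr_partialWithin (hu : UniqueDiffOn ℝ Ω) (l : List (Fin s)) (α : Fin s → ℕ)
    {n : ℕ} {g : EuclideanSpace ℝ (Fin s) → ℝ}
    (hg : ContDiffOn ℝ (n + (l.map α).sum : ℕ) g Ω) :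
    ContDiffOn ℝ n (l.foldr (fun i g => (partialWithin Ω i)^[α i] g) g) Ω := by
  induction l generalizing n with
  | nil => simpa using hg
  | cons a l ih =>
    rw [List.foldr_cons]
    refine contDiffOn_iterate_partialWithin hu (ih ?_) a
    rwa [List.map_cons, List.sum_cons, ← add_assoc] at hg

lemma foldr_iterate_add_single {A : Type*} (D : Fin s → A → A) (l : List (Fin s))
    (α : Fin s → ℕ) {i : Fin s} (hi : i ∉ l) (g : A) :
    l.foldr (fun j g => (D j)^[(α + Pi.single i 1 : Fin s → ℕ) j] g) g =
      l.foldr (fun j g => (D j)^[α j] g) g := by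
  induction l with
  | nil => rfl
  | cons a l ih =>
    rw [List.mem_cons, not_or] at hi
    rw [List.foldr_cons, List.foldr_cons, ih hi.2]
    simp [Pi.single_eq_of_ne (Ne.symm hi.1)]

/-- The additional derivative is commuted outwards past the blocks that precede `i` in the list; the
extra order of smoothness permits each exchange. -/
lemma eqOn_partialWithin_foldr (hconv : Convex ℝ Ω) (hint : (interior Ω).Nonempty)
    {l : List (Fin s)} (hl : l.Nodup) (α : Fin s → ℕ)
    {g : EuclideanSpace ℝ (Fin s) → ℝ} (hg : ContDiffOn ℝ ((l.map α).sum + 1 : ℕ) g Ω)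
    {i : Fin s} (hi : i ∈ l) :
    Set.EqOn (l.foldr (fun j g => (partialWithin Ω j)^[(α + Pi.single i 1 : Fin s → ℕ) j] g) g)
      (partialWithin Ω i (l.foldr (fun j g => (partialWithin Ω j)^[α j] g) g)) Ω := by
  have hu := uniqueDiffOn_convex hconv hint
  induction l with
  | nil => simp at hi
  | cons a l ih =>
    rw [List.nodup_cons] at hl
    rw [List.map_cons, List.sum_cons] at hg
    rw [List.foldr_cons, List.foldr_cons]
    by_cases hia : i = a
    · subst hia
      rw [foldr_iterate_add_single _ _ _ hl.1, Pi.add_apply, Pi.single_eq_same,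
        Function.iterate_succ_apply']
      exact Set.eqOn_refl _ _
    · have hil : i ∈ l := (List.mem_cons.1 hi).resolve_left hia
      rw [Pi.add_apply, Pi.single_eq_of_ne (Ne.symm hia), add_zero]
      refine (eqOn_iterate_partialWithin
        (ih hl.2 (hg.of_le (by norm_cast; omega)) hil) a _).trans ?_
      refine (eqOn_partialWithin_iterate_comm hconv hint ?_ i a).symm
      apply contDiffOn_foldr_partialWithin hu
      convert hg using 2
      ring

lemma multiLength_eq_sum_map (α : Fin s → ℕ) :
    multiLength α = ((List.finRange s).map α).sum := by
  rw [multiLength, ← List.ofFn_eq_map, List.sum_ofFn]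

lemma multiLength_add_single (α : Fin s → ℕ) (i : Fin s) :
    multiLength (α + Pi.single i 1) = multiLength α + 1 := by
  simp [multiLength, Finset.sum_add_distrib]

lemma exists_eq_add_single {α : Fin s → ℕ} {k : ℕ} (h : multiLength α = k + 1) :
    ∃ (β : Fin s → ℕ) (i : Fin s), α = β + Pi.single i 1 ∧ multiLength β = k := by
  obtain ⟨i, hi⟩ : ∃ i, α i ≠ 0 := by
    by_contra! hα
    simp [multiLength, hα] at h
  have hα : α = (α - Pi.single i 1) + Pi.single i 1 := by
    ext j
    by_cases hj : j = i
    · subst hj; simp; omega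
    · simp [Pi.single_eq_of_ne hj]
  refine ⟨_, i, hα, ?_⟩
  have := multiLength_add_single (α - Pi.single i 1) i
  rw [← hα, h] at this
  omega

lemma eq_zero_of_multiLength_eq_zero {α : Fin s → ℕ} (h : multiLength α = 0) : α = 0 := by
  ext i
  simpa using (Finset.sum_eq_zero_iff.1 h) i (Finset.mem_univ i)

lemma partialDeriv_zero (f : EuclideanSpace ℝ (Fin s) → ℝ) : partialDeriv Ω 0 f = f := by
  unfold partialDeriv
  simp

lemma contDiffOn_partialDeriv (hu : UniqueDiffOn ℝ Ω) {α : Fin s → ℕ} {n : ℕ}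
    {g : EuclideanSpace ℝ (Fin s) → ℝ} (hg : ContDiffOn ℝ (n + multiLength α : ℕ) g Ω) :
    ContDiffOn ℝ n (partialDeriv Ω α g) Ω :=
  contDiffOn_foldr_partialWithin hu _ _ (by rwa [← multiLength_eq_sum_map])

lemma eqOn_partialDeriv_add_single (hconv : Convex ℝ Ω) (hint : (interior Ω).Nonempty)
    {α : Fin s → ℕ} {g : EuclideanSpace ℝ (Fin s) → ℝ}
    (hg : ContDiffOn ℝ (multiLength α + 1 : ℕ) g Ω) (i : Fin s) :
    Set.EqOn (partialDeriv Ω (α + Pi.single i 1) g) (partialWithin Ω i (partialDeriv Ω α g)) Ω :=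
  eqOn_partialWithin_foldr hconv hint (List.nodup_finRange s) α
    (by rwa [← multiLength_eq_sum_map]) (List.mem_finRange i)

end Partial

/-! ### Derivatives of polynomials -/

section Poly
variable {s : ℕ}

/-- The mixed partial derivative `D^α` of a polynomial. -/
def polyDeriv (α : Fin s → ℕ) (q : MvPolynomial (Fin s) ℝ) : MvPolynomial (Fin s) ℝ :=
  (List.finRange s).foldr (fun i q => (MvPolynomial.pderiv i)^[α i] q) q

lemma polyDeriv_zero (q : MvPolynomial (Fin s) ℝ) : polyDeriv 0 q = q := by
  unfold polyDeriv
  simp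

lemma polyFun_injective :
    Function.Injective (polyFun : MvPolynomial (Fin s) ℝ → EuclideanSpace ℝ (Fin s) → ℝ) := by
  intro p q h
  exact MvPolynomial.funext fun x => by simpa [polyFun] using congr_fun h (WithLp.toLp 2 x)

lemma eqOn_partialWithin_polyFun {Ω : Set (EuclideanSpace ℝ (Fin s))} (hu : UniqueDiffOn ℝ Ω)
    (i : Fin s) (q : MvPolynomial (Fin s) ℝ) :
    Set.EqOn (partialWithin Ω i (polyFun q)) (polyFun (MvPolynomial.pderiv i q)) Ω := by
  intro x hx
  unfold partialWithin
  rw [(hasFDerivAt_polyFun q x).hasFDerivWithinAt.fderivWithin (hu x hx)]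
  simp

lemma eqOn_partialDeriv_polyFun {Ω : Set (EuclideanSpace ℝ (Fin s))} (hu : UniqueDiffOn ℝ Ω)
    (α : Fin s → ℕ) (q : MvPolynomial (Fin s) ℝ) :
    Set.EqOn (partialDeriv Ω α (polyFun q)) (polyFun (polyDeriv α q)) Ω := by
  have hiter : ∀ (i : Fin s) (k : ℕ) (q : MvPolynomial (Fin s) ℝ),
      Set.EqOn ((partialWithin Ω i)^[k] (polyFun q))
        (polyFun ((MvPolynomial.pderiv i)^[k] q)) Ω := by
    intro i k
    induction k with
    | zero => exact fun q => Set.eqOn_refl _ _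
    | succ k ih =>
      intro q
      rw [Function.iterate_succ_apply, Function.iterate_succ_apply]
      exact (eqOn_iterate_partialWithin (eqOn_partialWithin_polyFun hu i q) i k).trans (ih _)
  unfold partialDeriv polyDeriv
  induction List.finRange s with
  | nil => exact Set.eqOn_refl _ _
  | cons a l ih => exact (eqOn_iterate_partialWithin ih a _).trans (hiter a _ _)

lemma partialDeriv_univ_polyFun (α : Fin s → ℕ) (q : MvPolynomial (Fin s) ℝ) :
    partialDeriv Set.univ α (polyFun q) = polyFun (polyDeriv α q) :=
  funext fun x => eqOn_partialDeriv_polyFun uniqueDiffOn_univ α q (Set.mem_univ x)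

/-- Transferred from functions on the whole space, a polynomial being determined by its values. -/
lemma polyDeriv_add_single (α : Fin s → ℕ) (i : Fin s) (q : MvPolynomial (Fin s) ℝ) :
    polyDeriv (α + Pi.single i 1) q = MvPolynomial.pderiv i (polyDeriv α q) := by
  apply polyFun_injective
  funext x
  rw [← partialDeriv_univ_polyFun, eqOn_partialDeriv_add_single convex_univ (by simp)
    (contDiff_polyFun q _).contDiffOn i (Set.mem_univ x), partialDeriv_univ_polyFun,
    eqOn_partialWithin_polyFun uniqueDiffOn_univ i _ (Set.mem_univ x)]

lemma polyDeriv_induction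
    {P : (Fin s → ℕ) → (MvPolynomial (Fin s) ℝ → MvPolynomial (Fin s) ℝ) → Prop} (zero : P 0 id)
    (succ : ∀ α i, P α (polyDeriv α) →
      P (α + Pi.single i 1) (fun q => MvPolynomial.pderiv i (polyDeriv α q)))
    (α : Fin s → ℕ) : P α (polyDeriv α) := by
  induction hk : multiLength α generalizing α with
  | zero =>
    rw [eq_zero_of_multiLength_eq_zero hk]
    convert zero using 1
    exact funext polyDeriv_zero
  | succ k ih =>
    obtain ⟨β, i, rfl, hβ⟩ := exists_eq_add_single hk
    convert succ β i (ih β hβ) using 1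
    exact funext (polyDeriv_add_single β i)

lemma polyDeriv_add (α : Fin s → ℕ) (p q : MvPolynomial (Fin s) ℝ) :
    polyDeriv α (p + q) = polyDeriv α p + polyDeriv α q :=
  polyDeriv_induction (P := fun _ D => ∀ p q, D (p + q) = D p + D q) (fun _ _ => rfl)
    (fun α i h p q => by simp [h]) α p q

lemma totalDegree_polyDeriv_le {q : MvPolynomial (Fin s) ℝ} {n : ℕ} (hq : q.totalDegree ≤ n)
    (α : Fin s → ℕ) : (polyDeriv α q).totalDegree ≤ n - multiLength α :=
  polyDeriv_induction
    (P := fun α D => (D q).totalDegree ≤ n - multiLength α) (hq.trans (by simp [multiLength]))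
    (fun α i h => by
      rw [multiLength_add_single, Nat.sub_add_eq]
      exact totalDegree_pderiv_le i h) α

/-- The iterated Markov inequality on a ball. -/
lemma abs_polyDeriv_le {n : ℕ} {q : MvPolynomial (Fin s) ℝ}
    (hq : q.totalDegree ≤ n) {c : EuclideanSpace ℝ (Fin s)} {h A : ℝ} (hh : 0 < h)
    (hqA : ∀ x ∈ Metric.closedBall c h, |polyFun q x| ≤ A) (α : Fin s → ℕ)
    (hα : multiLength α ≤ n) {x : EuclideanSpace ℝ (Fin s)} (hx : x ∈ Metric.closedBall c h) :
    |polyFun (polyDeriv α q) x| ≤ MConst n α * A / h ^ multiLength α := by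
  induction hk : multiLength α generalizing α x with
  | zero =>
    rw [eq_zero_of_multiLength_eq_zero hk, polyDeriv_zero]
    simpa [MConst, multiLength] using hqA x hx
  | succ k ih =>
    obtain ⟨β, i, rfl, hβ⟩ := exists_eq_add_single hk
    rw [polyDeriv_add_single]
    -- After `k` derivatives the degree is at most `n - k`, so this step contributes the factor `(n
    -- - k)² / h`.
    refine (abs_pderiv_le (totalDegree_polyDeriv_le hq β) hh
      (fun y hy => ih β (by omega) hy hβ) i hx).trans_eq ?_
    unfold MConst
    rw [hk, hβ, Finset.prod_range_succ, Nat.cast_sub (by omega), pow_succ]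
    field_simp
    ring

/-- Differentiation shifts coefficients and multiplies them by positive integers. That the factor is
nonzero allows derivatives at a point to be prescribed. -/
lemma exists_coeff_polyDeriv (α : Fin s → ℕ) :
    ∀ m : Fin s →₀ ℕ, ∃ N : ℝ, N ≠ 0 ∧ ∀ q : MvPolynomial (Fin s) ℝ,
      (polyDeriv α q).coeff m = N * q.coeff (m + Finsupp.equivFunOnFinite.symm α) :=
  polyDeriv_induction
    (P := fun α D => ∀ m : Fin s →₀ ℕ, ∃ N : ℝ, N ≠ 0 ∧ ∀ q : MvPolynomial (Fin s) ℝ,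
      (D q).coeff m = N * q.coeff (m + Finsupp.equivFunOnFinite.symm α))
    (fun m => ⟨1, one_ne_zero, fun q => by
      rw [one_mul, id, show Finsupp.equivFunOnFinite.symm (0 : Fin s → ℕ) = 0 by ext; simp,
        add_zero]⟩)
    (fun α i h m => by
      obtain ⟨N, hN, hq⟩ := h (m + Finsupp.single i 1)
      refine ⟨N * (m i + 1), mul_ne_zero hN (by positivity), fun q => ?_⟩
      rw [MvPolynomial.coeff_pderiv, hq, mul_right_comm]
      congr 2
      ext j
      simp [Finsupp.single_apply, Pi.single_apply, eq_comm]
      ring) α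

/-- The polynomial `q (X + a)`. -/
def translate (a : EuclideanSpace ℝ (Fin s)) (q : MvPolynomial (Fin s) ℝ) :
    MvPolynomial (Fin s) ℝ :=
  MvPolynomial.aeval (fun j => MvPolynomial.X j + MvPolynomial.C (a j)) q

lemma polyFun_translate (a x : EuclideanSpace ℝ (Fin s)) (q : MvPolynomial (Fin s) ℝ) :
    polyFun (translate a q) x = polyFun q (x + a) := by
  induction q using MvPolynomial.induction_on with
  | C b => simp [polyFun, translate]
  | add p q hp hq => simp_all [polyFun, translate]
  | mul_X p j hp => simp_all [polyFun, translate]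

lemma pderiv_translate (a : EuclideanSpace ℝ (Fin s)) (i : Fin s) (q : MvPolynomial (Fin s) ℝ) :
    MvPolynomial.pderiv i (translate a q) = translate a (MvPolynomial.pderiv i q) := by
  induction q using MvPolynomial.induction_on with
  | C b => simp [translate]
  | add p q hp hq => simp_all [translate]
  | mul_X p j hp =>
    by_cases h : i = j <;>
    simp_all [translate, MvPolynomial.pderiv_X]

lemma polyDeriv_translate (a : EuclideanSpace ℝ (Fin s)) (α : Fin s → ℕ)
    (q : MvPolynomial (Fin s) ℝ) :
    polyDeriv α (translate a q) = translate a (polyDeriv α q) :=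
  polyDeriv_induction (P := fun _ D => D (translate a q) = translate a (D q)) rfl
    (fun α i h => by simp only [h, pderiv_translate]) α

lemma totalDegree_translate_le (a : EuclideanSpace ℝ (Fin s)) {q : MvPolynomial (Fin s) ℝ} {n : ℕ}
    (hq : q.totalDegree ≤ n) : (translate a q).totalDegree ≤ n := by
  unfold translate
  rw [MvPolynomial.aeval_def, MvPolynomial.eval₂_eq]
  refine MvPolynomial.totalDegree_finsetSum_le fun m hm => ?_
  refine (MvPolynomial.totalDegree_mul _ _).trans ?_
  rw [MvPolynomial.algebraMap_eq, MvPolynomial.totalDegree_C, zero_add]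
  refine (MvPolynomial.totalDegree_finsetProd _ _).trans ?_
  refine le_trans (Finset.sum_le_sum fun j _ => ?_) ((MvPolynomial.le_totalDegree hm).trans hq)
  refine (MvPolynomial.totalDegree_pow _ _).trans ?_
  refine (Nat.mul_le_mul_left _ (m := 1) ?_).trans_eq (mul_one _)
  refine (MvPolynomial.totalDegree_add _ _).trans ?_
  simp

lemma finite_multiLength_le (n : ℕ) : {α : Fin s → ℕ | multiLength α ≤ n}.Finite := by
  refine (Set.Finite.pi (t := fun _ : Fin s => Set.Iic n) fun _ => Set.finite_Iic n).subset ?_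
  intro α hα i _
  exact (Finset.single_le_sum (fun j _ => Nat.zero_le (α j)) (Finset.mem_univ i)).trans hα

/-- There is a polynomial of total degree at most `n` with prescribed derivatives up to order `n`
at a point. -/
lemma exists_polyDeriv_eq (n : ℕ) (a : EuclideanSpace ℝ (Fin s)) (c : (Fin s → ℕ) → ℝ) :
    ∃ T : MvPolynomial (Fin s) ℝ, T.totalDegree ≤ n ∧
      ∀ α, multiLength α ≤ n → polyFun (polyDeriv α T) a = c α := by
  -- At the origin only the monomial of exponent `α` contributes to `D^α`, with factor `N α`; hence
  -- the coefficients `c α / N α`, followed by a translation to `a`.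
  choose N hN hq using fun α : Fin s → ℕ => exists_coeff_polyDeriv α 0
  have hfin := finite_multiLength_le (s := s) n
  set T₀ : MvPolynomial (Fin s) ℝ := ∑ α ∈ hfin.toFinset,
    MvPolynomial.monomial (Finsupp.equivFunOnFinite.symm α) (c α / N α) with hT₀
  refine ⟨translate (-a) T₀, totalDegree_translate_le _ ?_, fun α hα => ?_⟩
  · refine MvPolynomial.totalDegree_finsetSum_le fun α hα => ?_
    refine (MvPolynomial.totalDegree_monomial_le _ _).trans ?_
    rw [Set.Finite.mem_toFinset] at hα
    rw [Finsupp.sum_fintype _ _ (by simp)]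
    exact hα
  · rw [polyDeriv_translate, polyFun_translate, add_neg_cancel]
    have : polyFun (polyDeriv α T₀) 0 = (polyDeriv α T₀).coeff 0 := by
      rw [← MvPolynomial.constantCoeff_eq, ← MvPolynomial.eval_zero']
      rfl
    rw [this, hq, zero_add, hT₀, MvPolynomial.coeff_sum]
    simp only [MvPolynomial.coeff_monomial, EmbeddingLike.apply_eq_iff_eq]
    rw [Finset.sum_ite_eq', if_pos (by simpa using hα), mul_div_cancel₀ _ (hN α)]

end Poly

/-! ### Taylor remainder -/

section Taylor
variable {s d : ℕ} {Ω K : Set (EuclideanSpace ℝ (Fin s))} {f : EuclideanSpace ℝ (Fin s) → ℝ}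

lemma seminorm_nonneg : 0 ≤ seminorm d Ω K f := by
  apply Real.sSup_nonneg
  rintro r ⟨α, _, u, _, v, _, _, rfl⟩
  positivity

/-- The supremum bounds its quotients only if they are bounded above; finitely many multi-indices,
each with a Lipschitz constant, ensure this. -/
lemma IsClassCd1.abs_partialDeriv_sub_le (hf : IsClassCd1 d Ω f) (hKΩ : K ⊆ Ω) {α : Fin s → ℕ}
    (hα : multiLength α = d) {u v : EuclideanSpace ℝ (Fin s)} (hu : u ∈ K) (hv : v ∈ K) :
    |partialDeriv Ω α f u - partialDeriv Ω α f v| ≤ seminorm d Ω K f * ‖u - v‖ := by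
  by_cases huv : u = v
  · simp [huv]
  have hpos : 0 < ‖u - v‖ := norm_sub_pos_iff.2 huv
  rw [← div_le_iff₀ hpos]
  refine le_csSup ?_ ⟨α, hα, u, hu, v, hv, huv, rfl⟩
  have hC : ∀ β : Fin s → ℕ, ∃ C : ℝ, multiLength β = d → ∀ u ∈ Ω, ∀ v ∈ Ω,
      |partialDeriv Ω β f u - partialDeriv Ω β f v| ≤ C * ‖u - v‖ := by
    intro β
    by_cases hβ : multiLength β = d
    · obtain ⟨C, hC⟩ := hf.2 β hβ
      exact ⟨C, fun _ u hu v hv => by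
        simpa [Real.dist_eq, dist_eq_norm] using hC.dist_le_mul u hu v hv⟩
    · exact ⟨0, fun h => absurd h hβ⟩
  choose C hC using hC
  obtain ⟨B, hB⟩ := ((finite_multiLength_le (s := s) d).image C).bddAbove
  refine ⟨B, ?_⟩
  rintro r ⟨β, hβ, u, hu, v, hv, huv, rfl⟩
  have hpos : 0 < ‖u - v‖ := norm_sub_pos_iff.2 huv
  rw [div_le_iff₀ hpos]
  exact (hC β hβ u (hKΩ hu) v (hKΩ hv)).trans
    (mul_le_mul_of_nonneg_right (hB ⟨β, hβ.le, rfl⟩) hpos.le)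

lemma fderivWithin_apply_eq_sum (g : EuclideanSpace ℝ (Fin s) → ℝ)
    (z v : EuclideanSpace ℝ (Fin s)) :
    fderivWithin ℝ g Ω z v = ∑ i, v i * partialWithin Ω i g z := by
  have hv : v = ∑ i, v i • (EuclideanSpace.single i 1 : EuclideanSpace ℝ (Fin s)) := by
    ext j; simp [Pi.single_apply]
  conv_lhs => rw [hv]
  simp [partialWithin]

/-- The Taylor remainder estimate, for a polynomial `T` that has the same derivatives as `f` up to
order `d` at `c`. -/
lemma abs_partialDeriv_sub_polyDeriv_le (hconv : Convex ℝ Ω) (hint : (interior Ω).Nonempty)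
    (hf : ContDiffOn ℝ d f Ω) (hK : Convex ℝ K) (hKΩ : K ⊆ Ω) {c : EuclideanSpace ℝ (Fin s)}
    (hc : c ∈ K) {T : MvPolynomial (Fin s) ℝ} (hTd : T.totalDegree ≤ d)
    (hT : ∀ α, multiLength α ≤ d → polyFun (polyDeriv α T) c = partialDeriv Ω α f c)
    {A : ℝ} (hA : ∀ α, multiLength α = d → ∀ x ∈ K,
      |partialDeriv Ω α f x - partialDeriv Ω α f c| ≤ A * ‖x - c‖)
    {j : ℕ} {α : Fin s → ℕ} (hj : multiLength α + j = d)
    {x : EuclideanSpace ℝ (Fin s)} (hx : x ∈ K) :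
    |partialDeriv Ω α f x - polyFun (polyDeriv α T) x| ≤
      A * (s : ℝ) ^ j / (j + 1).factorial * ‖x - c‖ ^ (j + 1) := by
  have hu := uniqueDiffOn_convex hconv hint
  -- Induction on the number `j` of derivatives left before order `d`. For `j = 0`, `D^α T` is
  -- constant and the Lipschitz bound applies.
  induction j generalizing α x with
  | zero =>
    have hdeg := totalDegree_polyDeriv_le hTd α
    rw [show d - multiLength α = 0 by omega, Nat.le_zero,
      MvPolynomial.totalDegree_eq_zero_iff_eq_C] at hdeg
    have h1 := hT α (by omega)
    rw [hdeg, polyFun_C] at h1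
    rw [hdeg, polyFun_C]
    simp only at h1 ⊢
    rw [h1]
    simpa using hA α (by omega) x hx
  | succ j ih =>
    set v := x - c with hv
    set G : EuclideanSpace ℝ (Fin s) → ℝ :=
      fun x => partialDeriv Ω α f x - polyFun (polyDeriv α T) x with hG
    have hmem : ∀ t ∈ Set.Icc (0 : ℝ) 1, c + t • v ∈ K := fun t ht =>
      hK.add_smul_sub_mem hc hx ht
    set D : ℝ → ℝ := fun t => ∑ i, v i * (partialDeriv Ω (α + Pi.single i 1) f (c + t • v) -
      polyFun (polyDeriv (α + Pi.single i 1) T) (c + t • v)) with hD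
    have hderiv : ∀ t ∈ Set.Icc (0 : ℝ) 1,
        HasDerivWithinAt (fun t => G (c + t • v)) (D t) (Set.Icc 0 1) t := by
      intro t ht
      have hz := hKΩ (hmem t ht)
      have hcd : ContDiffOn ℝ (1 : ℕ) (partialDeriv Ω α f) Ω :=
        contDiffOn_partialDeriv hu (hf.of_le (by norm_cast; omega))
      have h1 := ((hcd.differentiableOn (by norm_num)) _ hz).hasFDerivWithinAt.sub
        (hasFDerivAt_polyFun (polyDeriv α T) (c + t • v)).hasFDerivWithinAt
      have h2 : HasDerivWithinAt (fun t : ℝ => c + t • v) ((1 : ℝ) • v) (Set.Icc 0 1) t :=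
        (((hasDerivAt_id t).smul_const v).const_add c).hasDerivWithinAt
      refine (h1.comp_hasDerivWithinAt t h2 fun t ht => hKΩ (hmem t ht)).congr_deriv ?_
      rw [one_smul, sub_apply, fderivWithin_apply_eq_sum, hD]
      simp only [sum_apply, smul_apply, smul_eq_mul,
        PiLp.proj_apply, mul_sub, Finset.sum_sub_distrib]
      congr 1
      · refine Finset.sum_congr rfl fun i _ => ?_
        rw [eqOn_partialDeriv_add_single hconv hint (hf.of_le (by norm_cast; omega)) i hz]
      · refine Finset.sum_congr rfl fun i _ => ?_
        rw [polyDeriv_add_single, mul_comm]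
    have hvi : ∀ i, |v i| ≤ ‖v‖ := fun i => by
      simpa using PiLp.norm_apply_le v i
    -- The comparison function on the segment is `B t^(j+2)`. Each of the `s` terms of `D t` is
    -- bounded by induction, which gives the factor `s`; integrating `t^(j+1)` gives `1 / (j + 2)`.
    set B : ℝ := A * (s : ℝ) ^ (j + 1) / (j + 1 + 1).factorial * ‖v‖ ^ (j + 1 + 1) with hB
    have hDle : ∀ t ∈ Set.Icc (0 : ℝ) 1, |D t| ≤ B * ((j + 1 + 1 : ℕ) * t ^ (j + 1)) := by
      intro t ht
      have h1 : ∀ i, |v i * (partialDeriv Ω (α + Pi.single i 1) f (c + t • v) -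
          polyFun (polyDeriv (α + Pi.single i 1) T) (c + t • v))| ≤
          ‖v‖ * (A * (s : ℝ) ^ j / (j + 1).factorial * (t * ‖v‖) ^ (j + 1)) := by
        intro i
        rw [abs_mul]
        refine mul_le_mul (hvi i) ?_ (abs_nonneg _) (norm_nonneg _)
        refine (ih (by rw [multiLength_add_single]; omega) (hmem t ht)).trans_eq ?_
        rw [add_sub_cancel_left, norm_smul, Real.norm_of_nonneg ht.1]
      refine (Finset.abs_sum_le_sum_abs _ _).trans
        ((Finset.sum_le_sum fun i _ => h1 i).trans_eq ?_)
      rw [Finset.sum_const, Finset.card_univ, Fintype.card_fin, nsmul_eq_mul, hB,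
        Nat.factorial_succ (j + 1)]
      have : ((j + 1).factorial : ℝ) ≠ 0 := by positivity
      push_cast
      field_simp
      ring
    have hmain := image_norm_le_of_norm_deriv_right_le_deriv_boundary
      (f := fun t => G (c + t • v)) (f' := D) (a := 0) (b := 1)
      (B := fun t => B * t ^ (j + 1 + 1)) (B' := fun t => B * ((j + 1 + 1 : ℕ) * t ^ (j + 1)))
      (fun t ht => (hderiv t ht).continuousWithinAt)
      (fun t ht => (hderiv t ⟨ht.1, ht.2.le⟩).mono_of_mem_nhdsWithin
        (Icc_mem_nhdsGE_of_mem ht))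
      (by simp [hG, hT α (by omega)])
      (fun t => (hasDerivAt_pow (j + 1 + 1) t).const_mul B)
      (fun t ht => hDle t ⟨ht.1, ht.2.le⟩)
      (Set.right_mem_Icc.2 zero_le_one)
    simpa [hG, hv] using hmain

/-- The remainder above has `(j + 1)!` where `k_j` has `(j - 1)!`, so it is stronger than needed. -/
lemma pow_div_factorial_le_kConst (s j : ℕ) :
    (s : ℝ) ^ j / (j + 1).factorial ≤ kConst s j := by
  cases j with
  | zero => simp [kConst]
  | succ j =>
    simp only [kConst]
    refine div_le_div_of_nonneg_left (by positivity) (by positivity) ?_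
    exact_mod_cast Nat.factorial_le (by omega)

end Taylor

/-! ### Lagrange basis and Lebesgue constant -/

section Interpolation
variable {s m d : ℕ} {σ : Fin m → EuclideanSpace ℝ (Fin s)} (hσ : Unisolvent d σ)

lemma totalDegree_interpolant_le (y : Fin m → ℝ) : (interpolant hσ y).totalDegree ≤ d :=
  (hσ y).choose_spec.1.1

lemma polyFun_interpolant (y : Fin m → ℝ) (i : Fin m) : polyFun (interpolant hσ y) (σ i) = y i :=
  (hσ y).choose_spec.1.2 i

lemma polyFun_sum_smul {ι : Type*} (t : Finset ι) (a : ι → ℝ) (q : ι → MvPolynomial (Fin s) ℝ)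
    (x : EuclideanSpace ℝ (Fin s)) :
    polyFun (∑ i ∈ t, a i • q i) x = ∑ i ∈ t, a i * polyFun (q i) x := by
  simp [polyFun]

lemma eq_sum_smul_lagrange {q : MvPolynomial (Fin s) ℝ} (hq : q.totalDegree ≤ d) :
    q = ∑ i, polyFun q (σ i) • lagrange hσ i := by
  refine (hσ fun i => polyFun q (σ i)).unique ⟨hq, fun _ => rfl⟩ ⟨?_, fun j => ?_⟩
  · exact MvPolynomial.totalDegree_finsetSum_le fun i _ =>
      (MvPolynomial.totalDegree_smul_le _ _).trans (totalDegree_interpolant_le hσ _)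
  · rw [polyFun_sum_smul]
    simp [lagrange, polyFun_interpolant]

variable {Ω : Set (EuclideanSpace ℝ (Fin s))}

lemma sum_abs_lagrange_le (hΩ : IsCompact Ω) {x : EuclideanSpace ℝ (Fin s)} (hx : x ∈ Ω) :
    ∑ i, |polyFun (lagrange hσ i) x| ≤ lebesgueConstant hσ Ω := by
  refine le_csSup (hΩ.image ?_).bddAbove ⟨x, hx, rfl⟩
  exact continuous_finsetSum _ fun i _ => (contDiff_polyFun _ 0).continuous.abs

lemma abs_polyFun_le_mul_lebesgueConstant (hΩ : IsCompact Ω) {q : MvPolynomial (Fin s) ℝ}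
    (hq : q.totalDegree ≤ d) {A : ℝ} (hA0 : 0 ≤ A) (hA : ∀ i, |polyFun q (σ i)| ≤ A)
    {x : EuclideanSpace ℝ (Fin s)} (hx : x ∈ Ω) :
    |polyFun q x| ≤ A * lebesgueConstant hσ Ω := by
  rw [eq_sum_smul_lagrange hσ hq, polyFun_sum_smul]
  calc _ ≤ ∑ i, |polyFun q (σ i) * polyFun (lagrange hσ i) x| := Finset.abs_sum_le_sum_abs _ _
    _ ≤ ∑ i, A * |polyFun (lagrange hσ i) x| := by
        refine Finset.sum_le_sum fun i _ => ?_
        rw [abs_mul]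
        exact mul_le_mul_of_nonneg_right (hA i) (abs_nonneg _)
    _ ≤ A * lebesgueConstant hσ Ω := by
        rw [← Finset.mul_sum]
        exact mul_le_mul_of_nonneg_left (sum_abs_lagrange_le hσ hΩ hx) hA0

lemma norm_sub_le_nodeRadius (σ : Fin m → EuclideanSpace ℝ (Fin s))
    (c : EuclideanSpace ℝ (Fin s)) (i : Fin m) : ‖σ i - c‖ ≤ nodeRadius σ c :=
  le_ciSup (f := fun i => ‖σ i - c‖) (Set.finite_range _).bddAbove i

lemma nodeRadius_nonneg (σ : Fin m → EuclideanSpace ℝ (Fin s))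
    (c : EuclideanSpace ℝ (Fin s)) : 0 ≤ nodeRadius σ c :=
  Real.iSup_nonneg fun _ => norm_nonneg _

end Interpolation
-- Interpolation error
section Error
variable {s d : ℕ} {Ω : Set (EuclideanSpace ℝ (Fin s))}

lemma choose_add_eq_one {d s : ℕ} (h : (d + s).choose s ≤ 1) : d = 0 ∨ s = 0 := by
  by_contra! hds
  obtain ⟨d, rfl⟩ := Nat.exists_eq_succ_of_ne_zero hds.1
  obtain ⟨s, rfl⟩ := Nat.exists_eq_succ_of_ne_zero hds.2
  have h1 : 0 < (d + 1 + s).choose s := Nat.choose_pos (by omega)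
  have h2 : 0 < (d + 1 + s).choose (s + 1) := Nat.choose_pos (by omega)
  have h3 : (d + 1 + (s + 1)).choose (s + 1) =
    (d + 1 + s).choose s + (d + 1 + s).choose (s + 1) := Nat.choose_succ_succ _ _
  change (d + 1 + (s + 1)).choose (s + 1) ≤ 1 at h
  omega

/-- Radius zero puts every node at the centre, so there is only one; then `d = 0` or `s = 0`. -/
lemma multiLength_eq_zero_of_nodeRadius_eq_zero
    {σ : Fin ((d + s).choose s) → EuclideanSpace ℝ (Fin s)} (hσ : Function.Injective σ)
    {c : EuclideanSpace ℝ (Fin s)} (hc : nodeRadius σ c = 0) {ν : Fin s → ℕ}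
    (hν : multiLength ν ≤ d) : multiLength ν = 0 := by
  have hsub : Subsingleton (Fin ((d + s).choose s)) := ⟨fun i j => hσ <| by
    have h : ∀ i, σ i = c := fun i => by
      have := norm_sub_le_nodeRadius σ c i
      rw [hc] at this
      exact norm_sub_eq_zero_iff.1 (le_antisymm this (norm_nonneg _))
    rw [h i, h j]⟩
  rcases choose_add_eq_one (Fin.subsingleton_iff_le_one.1 hsub) with rfl | rfl
  · omega
  · simp [multiLength]

/-- The polynomial part of the interpolation error: the difference of the interpolating polynomial
and the Taylor polynomial at the center of the ball. -/
lemma abs_polyDeriv_sub_le (hΩcomp : IsCompact Ω) {m : ℕ}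
    {σ : Fin m → EuclideanSpace ℝ (Fin s)} (hσ : Unisolvent d σ)
    {c : EuclideanSpace ℝ (Fin s)} {h : ℝ} (hh : 0 < h) (hKΩ : Metric.closedBall c h ⊆ Ω)
    {r : MvPolynomial (Fin s) ℝ} (hr : r.totalDegree ≤ d) {A : ℝ} (hA0 : 0 ≤ A)
    (hA : ∀ i, |polyFun r (σ i)| ≤ A * h ^ (d + 1)) {ν : Fin s → ℕ} (hν : multiLength ν ≤ d)
    {x : EuclideanSpace ℝ (Fin s)} (hx : x ∈ Metric.closedBall c h) :
    |polyFun (polyDeriv ν r) x| ≤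
      A * MConst d ν * lebesgueConstant hσ Ω * h ^ (d - multiLength ν + 1) := by
  refine (abs_polyDeriv_le hr hh (fun y hy => abs_polyFun_le_mul_lebesgueConstant hσ hΩcomp hr
    (by positivity) hA (hKΩ hy)) ν hν hx).trans_eq ?_
  rw [show d + 1 = (d - multiLength ν + 1) + multiLength ν by omega, pow_add]
  field_simp

end Error

end PolyInterp

end

/-! ### The error bounds -/

theorem mainTheorem3 (s d : ℕ) (Ω : Set (EuclideanSpace ℝ (Fin s)))
    (hΩconv : Convex ℝ Ω) (hΩcomp : IsCompact Ω) (hΩint : (interior Ω).Nonempty)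
    (σ : Fin ((d + s).choose s) → EuclideanSpace ℝ (Fin s))
    (hσinj : Function.Injective σ) (hσΩ : ∀ i, σ i ∈ Ω)
    (hσ : PolyInterp.Unisolvent d σ)
    (f : EuclideanSpace ℝ (Fin s) → ℝ) (hf : PolyInterp.IsClassCd1 d Ω f)
    (xbar : EuclideanSpace ℝ (Fin s)) (h : ℝ) (hh : h = PolyInterp.nodeRadius σ xbar)
    (K : Set (EuclideanSpace ℝ (Fin s))) (hK : K = Metric.closedBall xbar h) (hKΩ : K ⊆ Ω)
    (p : EuclideanSpace ℝ (Fin s) → ℝ)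
    (hp : p = PolyInterp.polyFun (PolyInterp.interpolant hσ (fun i => f (σ i)))) :
    (∀ x ∈ K, ∀ ν : Fin s → ℕ, PolyInterp.multiLength ν ≤ d →
      |PolyInterp.partialDeriv Ω ν f x - PolyInterp.partialDeriv Set.univ ν p x| ≤
        PolyInterp.seminorm d Ω K f *
          (PolyInterp.kConst s (d - PolyInterp.multiLength ν) +
            PolyInterp.kConst s d * PolyInterp.MConst d ν * PolyInterp.lebesgueConstant hσ Ω) *
          h ^ (d - PolyInterp.multiLength ν + 1)) ∧
    (∀ ν : Fin s → ℕ, PolyInterp.multiLength ν ≤ d →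
      |PolyInterp.partialDeriv Ω ν f xbar - PolyInterp.partialDeriv Set.univ ν p xbar| ≤
        PolyInterp.seminorm d Ω K f * PolyInterp.kConst s d * PolyInterp.MConst d ν *
          PolyInterp.lebesgueConstant hσ Ω * h ^ (d - PolyInterp.multiLength ν + 1)) := by
  open PolyInterp in
  set q := interpolant hσ (fun i => f (σ i)) with hq
  have hh0 : 0 ≤ h := hh ▸ nodeRadius_nonneg σ xbar
  have hσh : ∀ i, ‖σ i - xbar‖ ≤ h := fun i => hh ▸ norm_sub_le_nodeRadius σ xbar i
  have hσK : ∀ i, σ i ∈ K := fun i => by rw [hK, mem_closedBall_iff_norm]; exact hσh i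
  have hcK : xbar ∈ K := by rw [hK]; exact Metric.mem_closedBall_self hh0
  have hKconv : Convex ℝ K := hK ▸ convex_closedBall xbar h
  have hpν : ∀ ν x, partialDeriv Set.univ ν p x = polyFun (polyDeriv ν q) x := fun ν x => by
    rw [hp, partialDeriv_univ_polyFun]
  simp only [hpν]
  -- Markov's inequality divides by `h`. If `h = 0`, then `K` is a single node and only `ν = 0`
  -- occurs, so the error is zero.
  rcases hh0.eq_or_lt with h0 | hpos
  · have hzero : ∀ x ∈ K, ∀ ν : Fin s → ℕ, multiLength ν ≤ d →
        |partialDeriv Ω ν f x - polyFun (polyDeriv ν q) x| = 0 := by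
      intro x hx ν hν
      have hν0 := eq_zero_of_multiLength_eq_zero
        (multiLength_eq_zero_of_nodeRadius_eq_zero hσinj (hh.symm.trans h0.symm) hν)
      rw [hK, ← h0, Metric.closedBall_zero, Set.mem_singleton_iff] at hx
      have hi : σ ⟨0, Nat.choose_pos (Nat.le_add_left s d)⟩ = x := by
        have := hσK ⟨0, Nat.choose_pos (Nat.le_add_left s d)⟩
        rw [hK, ← h0, Metric.closedBall_zero, Set.mem_singleton_iff] at this
        rw [this, hx]
      rw [hν0, partialDeriv_zero, polyDeriv_zero, ← hi, hq, polyFun_interpolant, sub_self,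
        abs_zero]
    refine ⟨fun x hx ν hν => ?_, fun ν hν => ?_⟩
    · rw [hzero x hx ν hν, ← h0]; simp
    · rw [hzero xbar hcK ν hν, ← h0]; simp
  · obtain ⟨T, hTd, hT⟩ := exists_polyDeriv_eq d xbar (fun α => partialDeriv Ω α f xbar)
    have htaylor : ∀ x ∈ K, ∀ ν : Fin s → ℕ, multiLength ν ≤ d →
        |partialDeriv Ω ν f x - polyFun (polyDeriv ν T) x| ≤
          PolyInterp.seminorm d Ω K f * kConst s (d - multiLength ν) *
            h ^ (d - multiLength ν + 1) := by
      intro x hx ν hν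
      refine (abs_partialDeriv_sub_polyDeriv_le hΩconv hΩint hf.1 hKconv hKΩ hcK hTd hT
        (fun α hα y hy => hf.abs_partialDeriv_sub_le hKΩ hα hy hcK)
        (Nat.add_sub_of_le hν) hx).trans ?_
      rw [mul_div_assoc]
      have hxh : ‖x - xbar‖ ≤ h := by rwa [hK, mem_closedBall_iff_norm] at hx
      have hs := seminorm_nonneg (d := d) (Ω := Ω) (K := K) (f := f)
      have hk := pow_div_factorial_le_kConst s (d - multiLength ν)
      have hk0 : 0 ≤ kConst s (d - multiLength ν) := le_trans (by positivity) hk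
      gcongr
    have hk0 : 0 ≤ kConst s d := le_trans (by positivity) (pow_div_factorial_le_kConst s d)
    have hr : ∀ x ∈ K, ∀ ν : Fin s → ℕ, multiLength ν ≤ d →
        |polyFun (polyDeriv ν (q - T)) x| ≤ PolyInterp.seminorm d Ω K f * kConst s d *
          MConst d ν * lebesgueConstant hσ Ω * h ^ (d - multiLength ν + 1) := by
      intro x hx ν hν
      refine abs_polyDeriv_sub_le hΩcomp hσ hpos (hK ▸ hKΩ) ?_
        (mul_nonneg seminorm_nonneg hk0) (fun i => ?_) hν (hK ▸ hx)
      · exact (MvPolynomial.totalDegree_sub _ _).trans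
          (max_le (totalDegree_interpolant_le hσ _) hTd)
      -- At a node `q - T` equals `f - T`, so the remainder of order zero applies.
      · have h1 := htaylor (σ i) (hσK i) 0 (by simp [multiLength])
        rw [partialDeriv_zero, polyDeriv_zero] at h1
        have h2 : polyFun (q - T) (σ i) = f (σ i) - polyFun T (σ i) := by
          rw [← polyFun_interpolant hσ (fun i => f (σ i)) i]
          simp [polyFun, hq]
        rw [h2]
        simpa [multiLength] using h1
    have hsplit : ∀ ν x, polyFun (polyDeriv ν q) x =
        polyFun (polyDeriv ν (q - T)) x + polyFun (polyDeriv ν T) x := by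
      intro ν x
      conv_lhs => rw [← sub_add_cancel q T, polyDeriv_add, polyFun_add]
      rfl
    refine ⟨fun x hx ν hν => ?_, fun ν hν => ?_⟩
    · rw [hsplit, show ∀ a b c : ℝ, a - (b + c) = (a - c) - b by intros; ring]
      refine (abs_sub _ _).trans ((add_le_add (htaylor x hx ν hν) (hr x hx ν hν)).trans_eq ?_)
      ring
    -- At the centre `D^ν f = D^ν T`, so only the polynomial part remains.
    · rw [hsplit, hT ν hν, sub_add_cancel_right, abs_neg]
      exact hr xbar hcK ν hν
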